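/- Let $\Gamma$ be a totally ordered abelian group with positive cone $\Gamma^+=\{x\in\Gamma: x\ge 0\}$, let $A$ be a $C^*$-algebra, and let $\alpha:\Gamma^+\to\operatorname{End}(A)$ be an action by endomorphisms with $\alpha_0=\mathrm{id}_A$, each of which is extendible, i.e. extends to a strictly continuous endomorphism of the multiplier algebra $M(A)$. A partial-isometric representation of $\Gamma^+$ in a unital $C^*$-algebra $M$ is a map $V:\Gamma^+\to M$ with $V_sV_s^*V_s=V_s$ and $V_{s+t}=V_sV_t$; it is isometric if moreover $V_s^*V_s=1$ for all $s$. A covariant partial-isometric representation of $(A,\Gamma^+,\alpha)$ on a Hilbert space $H$ is a pair $(\pi,V)$ of a non-degenerate representation $\pi:A\to B(H)$ and a partial-isometric representation $V:\Gamma^+\to B(H)$ such that $\pi(\alpha_s(a))=V_s\pi(a)V_s^*$ and $V_s^*V_s\pi(a)=\pi(a)V_s^*V_s$ for all $s\in\Gamma^+$, $a\in A$; it is a covariant isometric representation if every $V_s$ is an isometry (the second relation is then automatic). Covariant pairs in a $C^*$-algebra $B$ are defined in the same way, with a non-degenerate homomorphism $A\to B$ and a representation $\Gamma^+\to M(B)$.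 A bar denotes the canonical extension of a non-degenerate homomorphism to multiplier algebras. A partial-isometric crossed product $(A\times_\alpha^{\mathrm{piso}}\Gamma^+,j_A,j_{\Gamma^+})$ is a $C^*$-algebra with a covariant partial-isometric pair $(j_A,j_{\Gamma^+})$ such that for every covariant partial-isometric representation $(\pi,V)$ on a Hilbert space there is a non-degenerate representation $\pi\times V$ of $A\times_\alpha^{\mathrm{piso}}\Gamma^+$ with $(\pi\times V)\circ j_A=\pi$ and $\overline{\pi\times V}\circ j_{\Gamma^+}=V$, and such that $A\times_\alpha^{\mathrm{piso}}\Gamma^+=\overline{\operatorname{span}}\{j_{\Gamma^+}(s)^*j_A(a)j_{\Gamma^+}(t)\}$. An isometric crossed product $(A\times_\alpha^{\mathrm{iso}}\Gamma^+,i_A,i_{\Gamma^+})$ is a $C^*$-algebra, generated by the elements $i_A(a)i_{\Gamma^+}(s)$, with a covariant isometric pair $(i_A,i_{\Gamma^+})$ that has the same universal property for the covariant isometric representations on Hilbert spaces. Then, for any such crossed products, there is a unique non-degenerate homomorphism $\phi: A\times_\alpha^{\mathrm{piso}}\Gamma^+\to A\times_\alpha^{\mathrm{iso}}\Gamma^+$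 with $\phi\circ j_A=i_A$ and $\overline{\phi}\circ j_{\Gamma^+}=i_{\Gamma^+}$; it is surjective, and $$\ker\phi=\overline{\operatorname{span}}\{\,j_{\Gamma^+}(x)^*j_A(a)\bigl(1-j_{\Gamma^+}(t)^*j_{\Gamma^+}(t)\bigr)j_{\Gamma^+}(y) : a\in A,\ x,y,t\in\Gamma^+\,\}.$$ -/

import Mathlib

open scoped MultiplierAlgebra

universe u v

/-- The positive cone `Γ⁺ = {x ∈ Γ : 0 ≤ x}` of an ordered abelian group. -/
abbrev PosCone (Γ : Type v) [AddCommGroup Γ] [LinearOrder Γ] : Type v := {x : Γ // 0 ≤ x}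

/-- The strict topology on `M(A)`: the coarsest topology for which all the maps `m ↦ m a` and
`m ↦ a m`, for `a` in `A`, are continuous into the norm topology of `A`. -/
@[reducible]
noncomputable def strictTopology (A : Type u) [NonUnitalCStarAlgebra A] : TopologicalSpace 𝓜(ℂ, A) :=
  ⨅ a : A, (TopologicalSpace.induced (fun m : 𝓜(ℂ, A) => m.fst a) inferInstance ⊓
    TopologicalSpace.induced (fun m : 𝓜(ℂ, A) => m.snd a) inferInstance)

/-- An endomorphism of `A` is extendible if it extends to a strictly continuous endomorphism of
the multiplier algebra `M(A)` (which need not preserve the unit). -/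
def IsExtendible {A : Type u} [NonUnitalCStarAlgebra A] (f : A →⋆ₙₐ[ℂ] A) : Prop :=
  ∃ F : 𝓜(ℂ, A) →⋆ₙₐ[ℂ] 𝓜(ℂ, A),
    @Continuous _ _ (strictTopology A) (strictTopology A) F ∧ ∀ a : A, F (DoubleCentralizer.coe ℂ a) = DoubleCentralizer.coe ℂ (f a)

/-- A dynamical system `(A, Γ⁺, α)`: an action of `Γ⁺` on the C*-algebra `A` by extendible
endomorphisms, with `α 0 = id`. -/
structure EndAction (A : Type u) (Γ : Type v) [NonUnitalCStarAlgebra A]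
    [AddCommGroup Γ] [LinearOrder Γ] [IsOrderedAddMonoid Γ] where
  toEnd : PosCone Γ → A →⋆ₙₐ[ℂ] A
  toEnd_zero : toEnd 0 = NonUnitalStarAlgHom.id ℂ A
  toEnd_add : ∀ s t, toEnd (s + t) = (toEnd s).comp (toEnd t)
  extendible : ∀ s, IsExtendible (toEnd s)

section Representations

variable {Γ : Type v} [AddCommGroup Γ] [LinearOrder Γ] [IsOrderedAddMonoid Γ]
  {M : Type*} [Monoid M] [StarMul M]

/-- A partial-isometric representation of `Γ⁺` in a unital *-semigroup `M`
(used for `M = B(H)` and `M = M(B)`). -/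
structure IsPartialIsometricRep (V : PosCone Γ → M) : Prop where
  partialIsometry : ∀ s, V s * star (V s) * V s = V s
  map_add : ∀ s t, V (s + t) = V s * V t

/-- An isometric representation of `Γ⁺` in `M`. -/
structure IsIsometricRep (V : PosCone Γ → M) : Prop where
  isometry : ∀ s, star (V s) * V s = 1
  map_add : ∀ s t, V (s + t) = V s * V t

variable {A : Type u} [NonUnitalCStarAlgebra A]

/-- The relations of a covariant partial-isometric pair `(π, V)`. -/
structure IsPisoCovariant (α : EndAction A Γ) (π : A → M) (V : PosCone Γ → M) : Prop where
  rep : IsPartialIsometricRep V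
  covariant : ∀ s a, π (α.toEnd s a) = V s * π a * star (V s)
  commute : ∀ s a, star (V s) * V s * π a = π a * (star (V s) * V s)

/-- The relations of a covariant isometric pair `(π, V)`. -/
structure IsIsoCovariant (α : EndAction A Γ) (π : A → M) (V : PosCone Γ → M) : Prop where
  rep : IsIsometricRep V
  covariant : ∀ s a, π (α.toEnd s a) = V s * π a * star (V s)

end Representations

section Nondegenerate

variable {A : Type*} [NonUnitalCStarAlgebra A] {B : Type*} [NonUnitalCStarAlgebra B]
  {H : Type*} [NormedAddCommGroup H] [InnerProductSpace ℂ H] [CompleteSpace H]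

/-- A representation `π` of `A` on `H` is non-degenerate if `π(A)H` spans a dense subspace. -/
def IsNondegenerateRep (π : A →⋆ₙₐ[ℂ] (H →L[ℂ] H)) : Prop :=
  (Submodule.span ℂ (Set.range fun p : A × H => π p.1 p.2)).topologicalClosure = ⊤

/-- A homomorphism `f : A → B` is non-degenerate if `f(A)B` spans a dense subspace of `B`. -/
def IsNondegenerateHom (f : A →⋆ₙₐ[ℂ] B) : Prop :=
  (Submodule.span ℂ (Set.range fun p : A × B => f p.1 * p.2)).topologicalClosure = ⊤

/-- For a non-degenerate representation `ρ` of `B`, with canonical extension `ρ'` to `M(B)`: the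
statement `ρ' m = T`. Indeed `ρ' m` is the unique operator with `ρ' m (ρ b h) = ρ (m b) h`. -/
def RepExtendsTo (ρ : B →⋆ₙₐ[ℂ] (H →L[ℂ] H)) (m : 𝓜(ℂ, B)) (T : H →L[ℂ] H) : Prop :=
  ∀ b : B, ρ (m.fst b) = T * ρ b

/-- For a non-degenerate homomorphism `f : A → B`, with canonical extension `f' : M(A) → M(B)`:
the statement `f' m = n`. Indeed `f' m` is the unique multiplier with `f' m (f a) = f (m a)`. -/
def HomExtendsTo (f : A →⋆ₙₐ[ℂ] B) (m : 𝓜(ℂ, A)) (n : 𝓜(ℂ, B)) : Prop :=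
  ∀ a : A, f (m.fst a) = n.fst (f a)

/-- The product `m b n`, an element of `B`, of `b` in `B` with multipliers `m` and `n`. -/
noncomputable def multiplierSandwich (m : 𝓜(ℂ, B)) (b : B) (n : 𝓜(ℂ, B)) : B := m.fst (n.snd b)

/-- `multiplierSandwich m b n` is the product `m b n` taken in `M(B)`. -/
theorem coe_multiplierSandwich (m : 𝓜(ℂ, B)) (b : B) (n : 𝓜(ℂ, B)) :
    DoubleCentralizer.coe ℂ (multiplierSandwich m b n) = m * DoubleCentralizer.coe ℂ b * n := by
  have key : ∀ (k : 𝓜(ℂ, B)) (x y : B), k.fst (x * y) = k.fst x * y := by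
    intro k x y
    have h : ∀ z : B, z * (k.fst (x * y) - k.fst x * y) = 0 := by
      intro z
      rw [mul_sub, ← k.central, ← mul_assoc, ← mul_assoc, ← k.central, sub_self]
    exact sub_eq_zero.1 (CStarRing.star_mul_self_eq_zero_iff _ |>.1 (h _))
  have key' : ∀ (k : 𝓜(ℂ, B)) (x y : B), k.snd (x * y) = x * k.snd y := by
    intro k x y
    have h : ∀ z : B, (k.snd (x * y) - x * k.snd y) * z = 0 := by
      intro z
      rw [sub_mul, k.central, mul_assoc, mul_assoc, k.central, sub_self]
    exact sub_eq_zero.1 (CStarRing.mul_star_self_eq_zero_iff _ |>.1 (h _))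
  refine DoubleCentralizer.ext _ _ _ _ (Prod.ext ?_ ?_)
  · ext c
    simp [multiplierSandwich, ← key, n.central]
  · ext c
    simp [multiplierSandwich, ← key', ← m.central]

end Nondegenerate

section CrossedProducts

variable {A : Type u} [NonUnitalCStarAlgebra A]
  {Γ : Type v} [AddCommGroup Γ] [LinearOrder Γ] [IsOrderedAddMonoid Γ]
  {B : Type (max u v)} [NonUnitalCStarAlgebra B]

/-- `(B, jA, jΓ)` is a partial-isometric crossed product of `(A, Γ⁺, α)`. -/
structure IsPisoCrossedProduct (α : EndAction A Γ) (jA : A →⋆ₙₐ[ℂ] B)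
    (jΓ : PosCone Γ → 𝓜(ℂ, B)) : Prop where
  nondegenerate : IsNondegenerateHom jA
  covariant : IsPisoCovariant α (fun a => DoubleCentralizer.coe ℂ (jA a)) jΓ
  universal : ∀ (H : Type (max u v)) [NormedAddCommGroup H] [InnerProductSpace ℂ H]
    [CompleteSpace H] (π : A →⋆ₙₐ[ℂ] (H →L[ℂ] H)) (V : PosCone Γ → (H →L[ℂ] H)),
    IsNondegenerateRep π → IsPisoCovariant α π V →
    ∃ ρ : B →⋆ₙₐ[ℂ] (H →L[ℂ] H), IsNondegenerateRep ρ ∧ (∀ a, ρ (jA a) = π a) ∧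
      ∀ s, RepExtendsTo ρ (jΓ s) (V s)
  spanned : (Submodule.span ℂ (Set.range fun p : PosCone Γ × A × PosCone Γ =>
    multiplierSandwich (B := B) (star (jΓ p.1)) (jA p.2.1) (jΓ p.2.2))).topologicalClosure = ⊤

/-- `(C, iA, iΓ)` is an isometric crossed product of `(A, Γ⁺, α)`: a C*-algebra generated by a
universal covariant isometric pair. Generation makes the representation `ρ = π × V` unique. -/
structure IsIsoCrossedProduct (α : EndAction A Γ) (iA : A →⋆ₙₐ[ℂ] B)
    (iΓ : PosCone Γ → 𝓜(ℂ, B)) : Prop where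
  nondegenerate : IsNondegenerateHom iA
  covariant : IsIsoCovariant α (fun a => DoubleCentralizer.coe ℂ (iA a)) iΓ
  universal : ∀ (H : Type (max u v)) [NormedAddCommGroup H] [InnerProductSpace ℂ H]
    [CompleteSpace H] (π : A →⋆ₙₐ[ℂ] (H →L[ℂ] H)) (V : PosCone Γ → (H →L[ℂ] H)),
    IsNondegenerateRep π → IsIsoCovariant α π V →
    ∃ ρ : B →⋆ₙₐ[ℂ] (H →L[ℂ] H), IsNondegenerateRep ρ ∧ (∀ a, ρ (iA a) = π a) ∧
      ∀ s, RepExtendsTo ρ (iΓ s) (V s)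
  generated : (NonUnitalStarAlgebra.adjoin ℂ (Set.range fun p : A × PosCone Γ =>
    multiplierSandwich (B := B) 1 (iA p.1) (iΓ p.2))).topologicalClosure = ⊤

end CrossedProducts

/-- `φ : (B, jA, jΓ) → (C, iA, iΓ)` is the natural homomorphism `iA × iΓ`: it is non-degenerate,
`φ ∘ jA = iA`, and its extension to multiplier algebras carries `jΓ` to `iΓ`. -/
structure IsNaturalHom {A B C S : Type*} [NonUnitalCStarAlgebra A] [NonUnitalCStarAlgebra B]
    [NonUnitalCStarAlgebra C] (jA : A →⋆ₙₐ[ℂ] B) (jΓ : S → 𝓜(ℂ, B))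
    (iA : A →⋆ₙₐ[ℂ] C) (iΓ : S → 𝓜(ℂ, C)) (φ : B →⋆ₙₐ[ℂ] C) : Prop where
  nondegenerate : IsNondegenerateHom φ
  map_algebra : ∀ a, φ (jA a) = iA a
  map_semigroup : ∀ s, HomExtendsTo φ (jΓ s) (iΓ s)

/-!
The natural homomorphism `φ = iA × iΓ` is built from representations. A covariant isometric pair is
a covariant partial-isometric pair, so every non-degenerate representation `σ` of `C` gives, by the
universal property of `B`, a representation `ρ` of `B` with the same covariant pair. The pairs
`(b, c)` with `ρ b = σ c` for all such `ρ` and `σ` form a closed *-subalgebra `naturalGraph` of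
`B × C`. It is the graph of `φ`: its projection to `B` is injective because the GNS representations
of `C` separate points (`naturalGraph_right_unique`), and surjective because its range is closed and
contains the elements `j(x)* j(a) j(y)` that span `B` (`exists_mem_naturalGraph`). The range of `φ`
is closed too, hence `φ` is onto `C`.

Let `J` be the closed span in the theorem, `defectIdeal`. The extension of `φ` to multipliers
carries `1 - j(t)* j(t)` to `0`, so `φ` vanishes on `J`. For the converse, `J` is a closed two-sided ideal
(`IsPisoCovariant.isClosedStarIdeal_defectIdeal`). Two facts about partial-isometric representations
`V` of a totally ordered cone make it stable under left multiplication by `V_s`: initial and final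
projections commute, which gives `V_s V_{u+s}* = V_u* V_{u+s} V_{u+s}*`, and `V_u (1 - V_t* V_t)` is
either `0` or `(1 - V_w* V_w) V_u` with `t = w + u`. The final projections `V_x V_x*` multiply
`j(A)` into its closure (`IsPisoCovariant.final_mul_mem_closure`).

If `b ∉ J`, there is a non-degenerate representation `σ` of `B` that kills `J` but not `b`
(`IsClosedStarIdeal.exists_rep`): separate `-b* b` from the closed cone of the elements that are
positive modulo `J`, by Hahn–Banach, and take the GNS representation of the resulting positive
functional. This avoids the quotient C*-algebra `B / J`. The covariant pair of `σ` is isometric, so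
it comes from a representation `ρ` of `C`, and `ρ ∘ φ = σ` shows `φ b ≠ 0`.
-/

open scoped CStarAlgebra
open DoubleCentralizer

/-! ### Multipliers -/

namespace DoubleCentralizer

variable {B : Type*} [NonUnitalCStarAlgebra B]

theorem coe_injective : Function.Injective (DoubleCentralizer.coe ℂ : B → 𝓜(ℂ, B)) := by
  intro x y h
  have h1 : (x - y) * star (x - y) = 0 := by
    have := congrArg (fun m : 𝓜(ℂ, B) => m.fst (star (x - y))) h
    simpa [sub_mul, sub_eq_zero] using this
  exact sub_eq_zero.1 (CStarRing.mul_star_self_eq_zero_iff _ |>.1 h1)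

theorem fst_mul (m : 𝓜(ℂ, B)) (x y : B) : m.fst (x * y) = m.fst x * y := by
  rw [← sub_eq_zero, ← CStarRing.star_mul_self_eq_zero_iff, mul_sub, ← m.central, ← mul_assoc,
    ← mul_assoc, ← m.central, sub_self]

theorem snd_mul (m : 𝓜(ℂ, B)) (x y : B) : m.snd (x * y) = x * m.snd y := by
  rw [← sub_eq_zero, ← CStarRing.mul_star_self_eq_zero_iff, sub_mul, m.central, mul_assoc,
    mul_assoc, m.central, sub_self]

theorem mul_coe_coe (x y : B) :
    DoubleCentralizer.coe ℂ x * DoubleCentralizer.coe ℂ y = DoubleCentralizer.coe ℂ (x * y) :=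
  (map_mul (coeHom : B →⋆ₙₐ[ℂ] 𝓜(ℂ, B)) x y).symm

theorem mul_coe (m : 𝓜(ℂ, B)) (b : B) :
    m * DoubleCentralizer.coe ℂ b = DoubleCentralizer.coe ℂ (m.fst b) := by
  refine DoubleCentralizer.ext _ _ _ _ (Prod.ext ?_ ?_) <;> ext c
  · simp [fst_mul]
  · simp [m.central]

theorem coe_mul (m : 𝓜(ℂ, B)) (b : B) :
    DoubleCentralizer.coe ℂ b * m = DoubleCentralizer.coe ℂ (m.snd b) := by
  refine DoubleCentralizer.ext _ _ _ _ (Prod.ext ?_ ?_) <;> ext c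
  · simp [m.central]
  · simp [snd_mul]

theorem ext_fst {m n : 𝓜(ℂ, B)} (h : ∀ b, m.fst b = n.fst b) : m = n := by
  refine DoubleCentralizer.ext _ _ _ _ (Prod.ext (ContinuousLinearMap.ext h) ?_)
  ext c
  rw [← sub_eq_zero, ← CStarRing.mul_star_self_eq_zero_iff, sub_mul, m.central, n.central, h,
    sub_self]

theorem star_coe (b : B) :
    star (DoubleCentralizer.coe ℂ b : 𝓜(ℂ, B)) = DoubleCentralizer.coe ℂ (star b) :=
  (map_star (coeHom : B →⋆ₙₐ[ℂ] 𝓜(ℂ, B)) b).symm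

end DoubleCentralizer


/-! ### Extensions of non-degenerate homomorphisms to multipliers -/

section Extensions

variable {A B C : Type*} [NonUnitalCStarAlgebra A] [NonUnitalCStarAlgebra B]
  [NonUnitalCStarAlgebra C]
  {H : Type*} [NormedAddCommGroup H] [InnerProductSpace ℂ H] [CompleteSpace H]

/-- Non-degeneracy makes the extension to multipliers unique: an operator is determined by its
products with `ρ b`. -/
theorem IsNondegenerateRep.ext {ρ : B →⋆ₙₐ[ℂ] (H →L[ℂ] H)} (hρ : IsNondegenerateRep ρ)
    {S T : H →L[ℂ] H} (h : ∀ b, S * ρ b = T * ρ b) : S = T := by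
  apply ContinuousLinearMap.ext_on (s := Set.range fun p : B × H => ρ p.1 p.2)
  · rw [Submodule.dense_iff_topologicalClosure_eq_top]
    exact hρ
  · rintro _ ⟨p, rfl⟩
    exact congrArg (fun R : H →L[ℂ] H => R p.2) (h p.1)

theorem RepExtendsTo.star {ρ : B →⋆ₙₐ[ℂ] (H →L[ℂ] H)} (hρ : IsNondegenerateRep ρ)
    {m : 𝓜(ℂ, B)} {T : H →L[ℂ] H} (h : RepExtendsTo ρ m T) :
    RepExtendsTo ρ (star m) (star T) := by
  intro b
  have key : ∀ d, ρ (Star.star d) * ρ ((Star.star m).fst b) =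
      ρ (Star.star d) * (Star.star T * ρ b) := by
    intro d
    rw [← map_mul, ← mul_assoc, map_star, ← star_mul, ← h d, ← map_star, ← map_mul, ← central]
    simp
  apply star_injective
  refine hρ.ext fun d => star_injective ?_
  simpa [map_star] using key d

/-- The canonical extension is compatible with right multiplication by multipliers as well, although
`RepExtendsTo` only mentions left multiplication. -/
theorem RepExtendsTo.snd {ρ : B →⋆ₙₐ[ℂ] (H →L[ℂ] H)} (hρ : IsNondegenerateRep ρ)
    {m : 𝓜(ℂ, B)} {T : H →L[ℂ] H} (h : RepExtendsTo ρ m T) (b : B) :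
    ρ (m.snd b) = ρ b * T := by
  have := congrArg Star.star (h.star hρ (Star.star b))
  simpa [← map_star] using this

theorem RepExtendsTo.map_sandwich {ρ : B →⋆ₙₐ[ℂ] (H →L[ℂ] H)} (hρ : IsNondegenerateRep ρ)
    {m n : 𝓜(ℂ, B)} {S T : H →L[ℂ] H} (hm : RepExtendsTo ρ m S) (hn : RepExtendsTo ρ n T)
    (b : B) : ρ (multiplierSandwich m b n) = S * (ρ b * T) := by
  rw [multiplierSandwich, hm, hn.snd hρ]

/-- A homomorphism that is non-degenerate detects elements by left multiplication. -/
theorem IsNondegenerateHom.eq_of_mul_left {f : A →⋆ₙₐ[ℂ] B} (hf : IsNondegenerateHom f) {x y : B}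
    (h : ∀ a, f a * x = f a * y) : x = y := by
  have h2 : ∀ z : B, star (x - y) * z = 0 := by
    intro z
    have hz : z ∈ (Submodule.span ℂ
        (Set.range fun p : A × B => f p.1 * p.2)).topologicalClosure := by
      rw [show _ = _ from hf]; trivial
    refine Submodule.topologicalClosure_minimal
      (t := (ContinuousLinearMap.mul ℂ B (star (x - y))).ker) _
      (Submodule.span_le.2 ?_) (ContinuousLinearMap.isClosed_ker _) hz
    rintro _ ⟨p, rfl⟩
    have : star (x - y) * f p.1 = 0 := by
      apply star_injective
      simp [← map_star, mul_sub, h]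
    change star (x - y) * (f p.1 * p.2) = 0
    rw [← mul_assoc, this, zero_mul]
  exact sub_eq_zero.1 (CStarRing.star_mul_self_eq_zero_iff _ |>.1 (h2 _))

theorem HomExtendsTo.star {f : A →⋆ₙₐ[ℂ] B} (hf : IsNondegenerateHom f)
    {m : 𝓜(ℂ, A)} {n : 𝓜(ℂ, B)} (h : HomExtendsTo f m n) :
    HomExtendsTo f (star m) (star n) := by
  intro a
  refine hf.eq_of_mul_left fun d => ?_
  have := congrArg Star.star (h (Star.star d))
  rw [← map_mul, ← central, ← central, map_mul, star_snd, star_snd, map_star, this, map_star]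

theorem HomExtendsTo.snd {f : A →⋆ₙₐ[ℂ] B} (hf : IsNondegenerateHom f)
    {m : 𝓜(ℂ, A)} {n : 𝓜(ℂ, B)} (h : HomExtendsTo f m n) (a : A) :
    f (m.snd a) = n.snd (f a) := by
  have := congrArg Star.star (h.star hf (Star.star a))
  simpa [← map_star] using this

theorem HomExtendsTo.map_sandwich {f : A →⋆ₙₐ[ℂ] B} (hf : IsNondegenerateHom f)
    {m₁ m₂ : 𝓜(ℂ, A)} {n₁ n₂ : 𝓜(ℂ, B)} (h₁ : HomExtendsTo f m₁ n₁) (h₂ : HomExtendsTo f m₂ n₂)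
    (a : A) : f (multiplierSandwich m₁ a m₂) = multiplierSandwich n₁ (f a) n₂ := by
  rw [multiplierSandwich, h₁, h₂.snd hf, multiplierSandwich]

theorem HomExtendsTo.one (f : A →⋆ₙₐ[ℂ] B) : HomExtendsTo f 1 1 := fun _ => rfl

theorem HomExtendsTo.mul {f : A →⋆ₙₐ[ℂ] B} {m₁ m₂ : 𝓜(ℂ, A)} {n₁ n₂ : 𝓜(ℂ, B)}
    (h₁ : HomExtendsTo f m₁ n₁) (h₂ : HomExtendsTo f m₂ n₂) :
    HomExtendsTo f (m₁ * m₂) (n₁ * n₂) := fun a =>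
  (h₁ (m₂.fst a)).trans (congrArg n₁.fst (h₂ a))

theorem HomExtendsTo.sub {f : A →⋆ₙₐ[ℂ] B} {m₁ m₂ : 𝓜(ℂ, A)} {n₁ n₂ : 𝓜(ℂ, B)}
    (h₁ : HomExtendsTo f m₁ n₁) (h₂ : HomExtendsTo f m₂ n₂) :
    HomExtendsTo f (m₁ - m₂) (n₁ - n₂) := fun a => by
  change f (m₁.fst a - m₂.fst a) = n₁.fst (f a) - n₂.fst (f a)
  rw [map_sub, h₁, h₂]

end Extensions

/-! ### Ranges of *-homomorphisms -/

section Range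

variable {B C : Type*} [NonUnitalCStarAlgebra B] [NonUnitalCStarAlgebra C]

/-- A self-adjoint element in the range of a *-homomorphism has a preimage of no larger norm:
truncate a self-adjoint preimage by functional calculus. -/
theorem exists_preimage_norm_le_of_isSelfAdjoint (φ : B →⋆ₙₐ[ℂ] C) {b : B}
    (hb : IsSelfAdjoint b) : ∃ b', φ b' = φ b ∧ ‖b'‖ ≤ ‖φ b‖ := by
  let r := ‖φ b‖
  let g : ℝ → ℝ := fun x => max (-r) (min r x)
  have hr : 0 ≤ r := norm_nonneg _
  have hg : Continuous g := by fun_prop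
  have hg0 : g 0 = 0 := by simp [g, hr]
  refine ⟨cfcₙ g b, ?_, ?_⟩
  · have hφ := map_continuous φ
    have hφb : IsSelfAdjoint (φ b) := hb.map φ
    rw [NonUnitalStarAlgHomClass.map_cfcₙ φ (S := ℂ) g b hg.continuousOn hg0 hφ hb hφb]
    conv_rhs => rw [← cfcₙ_id ℝ (φ b)]
    refine cfcₙ_congr fun x hx => ?_
    have := abs_le.1 (NonUnitalIsometricContinuousFunctionalCalculus.norm_quasispectrum_le
      (φ b) hx)
    simp [g, this.1, this.2, r]
  · refine norm_cfcₙ_le fun x _ => ?_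
    rw [Real.norm_eq_abs, abs_le]
    exact ⟨le_max_left _ _, max_le (by linarith) (min_le_left _ _)⟩

/-- Real and imaginary parts of an element `c` of the range have preimages of norm at most `‖c‖`, so
every such `c` has a preimage of norm at most `2 ‖c‖`. -/
theorem isClosed_range_nonUnitalStarAlgHom (φ : B →⋆ₙₐ[ℂ] C) : IsClosed (Set.range φ) := by
  let f : NormedAddGroupHom B C := (φ : B →+ C).mkNormedAddGroupHom 1 fun b => by
    simpa using NonUnitalStarAlgHom.norm_apply_le φ b
  have hf : f.SurjectiveOnWith f.range 2 := by
    rintro c ⟨b, rfl⟩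
    obtain ⟨x, hx, hx'⟩ := exists_preimage_norm_le_of_isSelfAdjoint φ (realPart b).2
    obtain ⟨y, hy, hy'⟩ := exists_preimage_norm_le_of_isSelfAdjoint φ (imaginaryPart b).2
    have h1 : φ (realPart b : B) = realPart (φ b) := by
      simp [realPart_apply_coe, map_star,
        map_real_smul φ (map_continuous φ)]
    have h2 : φ (imaginaryPart b : B) = imaginaryPart (φ b) := by
      simp [imaginaryPart_apply_coe, map_star,
        map_real_smul φ (map_continuous φ)]
    have h1' : ‖φ (realPart b : B)‖ ≤ ‖φ b‖ := by
      rw [h1]; exact realPart.norm_le (φ b)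
    have h2' : ‖φ (imaginaryPart b : B)‖ ≤ ‖φ b‖ := by
      rw [h2]; exact imaginaryPart.norm_le (φ b)
    refine ⟨x + Complex.I • y, ?_, ?_⟩
    · change φ (x + Complex.I • y) = φ b
      rw [map_add, map_smul, hx, hy, h1, h2, realPart_add_I_smul_imaginaryPart]
    · calc ‖x + Complex.I • y‖ ≤ ‖x‖ + ‖Complex.I • y‖ := norm_add_le _ _
        _ = ‖x‖ + ‖y‖ := by rw [norm_smul, Complex.norm_I, one_mul]
        _ ≤ 2 * ‖φ b‖ := by linarith
  refine isClosed_of_closure_subset fun c hc => ?_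
  obtain ⟨b, hb, -⟩ := controlled_closure_of_complete two_pos one_pos hf c (by
    rw [← SetLike.mem_coe, AddSubgroup.topologicalClosure_coe]
    exact hc)
  exact ⟨b, hb⟩

end Range

/-! ### Separating points from ideals by positive functionals -/

section Separation

open scoped ComplexOrder

variable {B : Type*} [NonUnitalCStarAlgebra B]

/-- A closed two-sided ideal of a C*-algebra. Only left ideals closed under the involution are
required: they are two-sided. -/
structure IsClosedStarIdeal (J : Submodule ℂ B) : Prop where
  isClosed : IsClosed (J : Set B)
  mul_mem_left : ∀ (b : B) {x : B}, x ∈ J → b * x ∈ J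
  star_mem : ∀ {x : B}, x ∈ J → star x ∈ J

theorem IsClosedStarIdeal.mul_mem_right {J : Submodule ℂ B} (hJ : IsClosedStarIdeal J) {x : B}
    (hx : x ∈ J) (b : B) : x * b ∈ J := by
  simpa using hJ.star_mem (hJ.mul_mem_left (star b) (hJ.star_mem hx))

theorem isClosedStarIdeal_bot : IsClosedStarIdeal (⊥ : Submodule ℂ B) where
  isClosed := by simp
  mul_mem_left b x hx := by simp_all
  star_mem hx := by simp_all

/-- An element `e = i h` of the ideal generated by `i` for which `(1 - e) i (1 - e)` has small norm;
`e` is `i² (ε² + i²)⁻¹` in the sense of functional calculus. -/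
theorem exists_approx_unit_of_isSelfAdjoint {i : B} (hi : IsSelfAdjoint i) {ε : ℝ} (hε : 0 < ε) :
    ∃ h : B, IsSelfAdjoint (i * h) ∧ ‖i * h‖ ≤ 1 ∧
      ‖i - i * h * i - i * (i * h) + i * h * i * (i * h)‖ ≤ ε := by
  have hpos : ∀ x : ℝ, ε ^ 2 + x ^ 2 ≠ 0 := fun x => by positivity
  let k : ℝ → ℝ := fun x => x / (ε ^ 2 + x ^ 2)
  have hk : Continuous k := by
    unfold k
    fun_prop (disch := exact hpos _)
  let g : ℝ → ℝ := fun x => x * k x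
  have hg : Continuous g := by fun_prop
  have hk0 : k 0 = 0 := by simp [k]
  have hg0 : g 0 = 0 := by simp [g]
  have he : i * cfcₙ k i = cfcₙ g i := by
    rw [cfcₙ_mul (fun x : ℝ => x) k i (by fun_prop) (by simp) hk.continuousOn hk0, cfcₙ_id' ℝ i]
  refine ⟨cfcₙ k i, ?_, ?_, ?_⟩ <;> rw [he]
  · exact cfcₙ_predicate g i
  · refine norm_cfcₙ_le fun x _ => ?_
    rw [Real.norm_eq_abs, abs_le]
    constructor
    · have : 0 ≤ g x := by
        simp only [g, k]
        rw [mul_div_assoc']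
        exact div_nonneg (mul_self_nonneg x) (by positivity)
      linarith
    · simp only [g, k]
      rw [mul_div_assoc', div_le_one (by positivity)]
      nlinarith [sq_nonneg ε]
  · have key : i - cfcₙ g i * i - i * cfcₙ g i + cfcₙ g i * i * cfcₙ g i =
        cfcₙ (fun x => x - g x * x - x * g x + g x * x * g x) i := by
      rw [cfcₙ_add (fun x => x - g x * x - x * g x) (fun x => g x * x * g x) i,
        cfcₙ_sub (fun x => x - g x * x) (fun x => x * g x) i, cfcₙ_sub (fun x => x)
        (fun x => g x * x) i, cfcₙ_mul (fun x => g x * x) g i, cfcₙ_mul g (fun x => x) i,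
        cfcₙ_mul (fun x => x) g i, cfcₙ_id' ℝ i]
    rw [key]
    refine norm_cfcₙ_le fun x _ => ?_
    have h1 : x - g x * x - x * g x + g x * x * g x = x * ε ^ 4 / (ε ^ 2 + x ^ 2) ^ 2 := by
      simp only [g, k]
      field_simp
      ring
    rw [h1, Real.norm_eq_abs, abs_div, abs_mul, abs_of_pos (by positivity : 0 < ε ^ 4),
      abs_of_pos (by positivity : 0 < (ε ^ 2 + x ^ 2) ^ 2), div_le_iff₀ (by positivity)]
    have hx : |x| * ε ≤ ε ^ 2 + x ^ 2 := by
      rw [← sq_abs x]; nlinarith [sq_nonneg (|x| - ε), abs_nonneg x]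
    have h2 : ε ^ 2 ≤ ε ^ 2 + x ^ 2 := by nlinarith [sq_nonneg x]
    calc |x| * ε ^ 4 = ε * ((|x| * ε) * ε ^ 2) := by ring
      _ ≤ ε * ((ε ^ 2 + x ^ 2) * (ε ^ 2 + x ^ 2)) := by gcongr
      _ = ε * (ε ^ 2 + x ^ 2) ^ 2 := by ring

variable [PartialOrder B] [StarOrderedRing B]

/-- If a positive element `p` can be added to `b* b` so that the sum is close to the ideal `J`,
then `b` is close to `J`. -/
theorem IsClosedStarIdeal.norm_le_of_add_nonneg {J : Submodule ℂ B} (hJ : IsClosedStarIdeal J)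
    {b p i : B} (hp : 0 ≤ p) (hi : i ∈ J) (his : IsSelfAdjoint i) {ε : ℝ} (hε : 0 < ε)
    (h : ‖p + i + star b * b‖ ≤ ε) : ∃ j ∈ J, ‖b - j‖ ^ 2 ≤ 5 * ε := by
  obtain ⟨h', he, he1, hei⟩ := exists_approx_unit_of_isSelfAdjoint his hε
  have heJ : i * h' ∈ J := hJ.mul_mem_right hi _
  generalize i * h' = e at *
  refine ⟨b * e, hJ.mul_mem_left _ heJ, ?_⟩
  obtain ⟨q, rfl⟩ := CStarAlgebra.nonneg_iff_eq_star_mul_self.1 hp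
  -- compress by `1 - e`
  have hq : 0 ≤ star (q - q * e) * (q - q * e) := star_mul_self_nonneg _
  set x := star q * q + i + star b * b with hx
  have hsum : star (b - b * e) * (b - b * e) + star (q - q * e) * (q - q * e) =
      (x - e * x - x * e + e * x * e) - (i - e * i - i * e + e * i * e) := by
    simp only [hx, star_sub, star_mul, he.star_eq]
    noncomm_ring
  have hle : star (b - b * e) * (b - b * e) ≤
      (x - e * x - x * e + e * x * e) - (i - e * i - i * e + e * i * e) := by
    rw [← hsum]
    exact le_add_of_nonneg_right hq
  have h1 := CStarAlgebra.norm_le_norm_of_nonneg_of_le (star_mul_self_nonneg _) hle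
  rw [CStarRing.norm_star_mul_self, ← sq] at h1
  have hex : ‖e * x‖ ≤ ε :=
    (norm_mul_le _ _).trans ((mul_le_of_le_one_left (norm_nonneg _) he1).trans h)
  have hxe : ‖x * e‖ ≤ ε :=
    (norm_mul_le _ _).trans ((mul_le_of_le_one_right (norm_nonneg _) he1).trans h)
  have hexe : ‖e * x * e‖ ≤ ε :=
    (norm_mul_le _ _).trans ((mul_le_of_le_one_right (norm_nonneg _) he1).trans hex)
  have h2 : ‖(x - e * x - x * e + e * x * e) - (i - e * i - i * e + e * i * e)‖ ≤
      ‖x‖ + ‖e * x‖ + ‖x * e‖ + ‖e * x * e‖ + ‖i - e * i - i * e + e * i * e‖ :=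
    (norm_sub_le _ _).trans (add_le_add_left ((norm_add_le _ _).trans (add_le_add_left
      ((norm_sub_le _ _).trans (add_le_add_left (norm_sub_le _ _) _)) _)) _)
  linarith

/-- The convex cone of the elements whose real part is positive modulo the subspace `J`. -/
def positiveModCone (J : Submodule ℂ B) : PointedCone ℝ B where
  carrier := {x | ∃ i ∈ J, 0 ≤ (realPart (x - i) : B)}
  zero_mem' := ⟨0, J.zero_mem, by simp⟩
  add_mem' := by
    rintro x y ⟨i, hi, hx⟩ ⟨j, hj, hy⟩
    refine ⟨i + j, J.add_mem hi hj, ?_⟩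
    rw [add_sub_add_comm, map_add]
    exact add_nonneg hx hy
  smul_mem' := by
    rintro r x ⟨i, hi, hx⟩
    refine ⟨((r : ℝ) : ℂ) • i, J.smul_mem _ hi, ?_⟩
    have : r • x - ((r : ℝ) : ℂ) • i = (r : ℝ) • (x - i) := by
      rw [smul_sub, Complex.coe_smul]; rfl
    rw [this, map_smul]
    exact smul_nonneg r.2 hx

theorem IsClosedStarIdeal.neg_star_mul_self_notMem_closure {J : Submodule ℂ B}
    (hJ : IsClosedStarIdeal J) {b : B} (hb : b ∉ J) :
    -(star b * b) ∉ closure (positiveModCone J : Set B) := by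
  intro hmem
  apply hb
  rw [← SetLike.mem_coe, ← hJ.isClosed.closure_eq, Metric.mem_closure_iff]
  intro δ hδ
  obtain ⟨x, ⟨i, hi, hx⟩, hxd⟩ := Metric.mem_closure_iff.1 hmem (δ ^ 2 / 6) (by positivity)
  have hre : (realPart (x + star b * b) : B) =
      realPart (x - i) + realPart i + star b * b := by
    have hs : (realPart (star b * b) : B) = star b * b :=
      (IsSelfAdjoint.star_mul_self b).coe_realPart
    rw [map_sub, map_add]
    simp [hs]
  have hri : (realPart i : B) ∈ J := by
    rw [realPart_apply_coe, ← Complex.coe_smul]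
    exact J.smul_mem _ (J.add_mem hi (hJ.star_mem hi))
  obtain ⟨j, hj, hbj⟩ := hJ.norm_le_of_add_nonneg (b := b) (ε := δ ^ 2 / 6) hx hri (realPart i).2
    (by positivity) (by
      rw [← hre]
      refine (realPart.norm_le (x + star b * b)).trans ?_
      rw [dist_comm, dist_eq_norm, sub_neg_eq_add] at hxd
      exact hxd.le)
  refine ⟨j, hj, ?_⟩
  rw [dist_eq_norm]
  apply lt_of_pow_lt_pow_left₀ 2 hδ.le
  nlinarith [sq_pos_of_pos hδ]

/-- A positive functional that vanishes on the ideal `J` and separates `b` from it, by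
Hahn–Banach. -/
theorem IsClosedStarIdeal.exists_positive {J : Submodule ℂ B} (hJ : IsClosedStarIdeal J) {b : B}
    (hb : b ∉ J) : ∃ f : B →ₚ[ℂ] ℂ, (∀ x ∈ J, f x = 0) ∧ f (star b * b) ≠ 0 := by
  let K : ProperCone ℝ B := ⟨(positiveModCone J).closure, isClosed_closure⟩
  obtain ⟨f, hf, hfb⟩ := K.hyperplane_separation_point (x₀ := -(star b * b))
    (hJ.neg_star_mul_self_notMem_closure hb)
  replace hf : ∀ x ∈ positiveModCone J, 0 ≤ f x := fun x hx => hf x (subset_closure hx)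
  have hJ0 : ∀ x ∈ J, f x = 0 := fun x hx => le_antisymm
    (by simpa using hf (-x) ⟨-x, J.neg_mem hx, by simp⟩) (hf x ⟨x, hx, by simp⟩)
  have hI : ∀ p : B, IsSelfAdjoint p → f (Complex.I • p) = 0 := fun p hp => le_antisymm
    (by simpa using hf (-(Complex.I • p)) ⟨0, J.zero_mem, by simp [hp.imaginaryPart]⟩)
    (hf _ ⟨0, J.zero_mem, by simp [hp.imaginaryPart]⟩)
  -- The cone contains `i p` and `-i p` for self-adjoint `p`, so the complexification of `f` agrees
  -- with `f` on self-adjoint elements.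
  let F : B →ₗ[ℂ] ℂ := (f.extendRCLike : StrongDual ℂ B)
  have hF : ∀ x, F x = (f x : ℂ) - Complex.I * (f (Complex.I • x) : ℂ) := fun x => by
    simp [F, StrongDual.extendRCLike_apply]
  have hFsa : ∀ p, IsSelfAdjoint p → F p = (f p : ℂ) := fun p hp => by simp [hF, hI p hp]
  refine ⟨.mk₀ F fun p hp => ?_, fun x hx => ?_, ?_⟩
  · rw [hFsa p (.of_nonneg hp)]
    exact_mod_cast hf p ⟨0, J.zero_mem, by
      rwa [sub_zero, (IsSelfAdjoint.of_nonneg hp).coe_realPart]⟩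
  · change F x = 0
    simp [hF, hJ0 x hx, hJ0 _ (J.smul_mem Complex.I hx)]
  · change F _ ≠ 0
    rw [hFsa _ (.star_mul_self b)]
    have : 0 < f (star b * b) := by simpa using hfb
    exact_mod_cast this.ne'

end Separation

/-! ### GNS representations of multipliers -/

section GNS

open scoped ComplexOrder
open UniformSpace

variable {B : Type*} [NonUnitalCStarAlgebra B] [PartialOrder B] [StarOrderedRing B]

/-- The inequality `b* m* m b ≤ ‖m‖² b* b`, from `‖m‖² - m* m = k* k` in the multiplier algebra. -/
theorem DoubleCentralizer.star_fst_mul_fst_le (m : 𝓜(ℂ, B)) (b : B) :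
    star (m.fst b) * m.fst b ≤ ((‖m‖ : ℂ) ^ 2) • (star b * b) := by
  let _ := CStarAlgebra.spectralOrder 𝓜(ℂ, B)
  have := CStarAlgebra.spectralOrderedRing 𝓜(ℂ, B)
  obtain ⟨k, hk⟩ := CStarAlgebra.nonneg_iff_eq_star_mul_self.1
    (sub_nonneg.2 (CStarAlgebra.star_mul_le_algebraMap_norm_sq (a := m)))
  have hk' : ∀ c : B, (star k).fst (k.fst c) = ((‖m‖ : ℂ) ^ 2) • c - (star m).fst (m.fst c) := by
    intro c
    have h : algebraMap ℝ 𝓜(ℂ, B) (‖m‖ ^ 2) = ((‖m‖ : ℂ) ^ 2) • (1 : 𝓜(ℂ, B)) := by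
      rw [Algebra.algebraMap_eq_smul_one, ← Complex.coe_smul, Complex.ofReal_pow]
    rw [h] at hk
    exact (congrArg (fun n : 𝓜(ℂ, B) => n.fst c) hk).symm
  rw [← sub_nonneg]
  have : ((‖m‖ : ℂ) ^ 2) • (star b * b) - star (m.fst b) * m.fst b =
      star (k.fst b) * k.fst b := by
    have h1 : ∀ n : 𝓜(ℂ, B), star (n.fst b) * n.fst b = star b * (star n).fst (n.fst b) := by
      intro n
      rw [star_fst, ← star_mul, central, star_mul, star_star]
    rw [h1, h1, hk', mul_sub, mul_smul_comm]
  rw [this]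
  exact star_mul_self_nonneg _

namespace PositiveLinearMap

variable (f : B →ₚ[ℂ] ℂ)

/-- Left multiplication by a multiplier on the pre-Hilbert space of the GNS construction. -/
noncomputable def multiplierPreGNS (m : 𝓜(ℂ, B)) : f.PreGNS →L[ℂ] f.PreGNS :=
  (f.toPreGNS.toLinearMap ∘ₗ m.fst.toLinearMap ∘ₗ f.ofPreGNS.toLinearMap).mkContinuous ‖m‖
    fun x => by
      rw [← sq_le_sq₀ (by positivity) (by positivity), mul_pow, ← Complex.real_le_real]
      push_cast
      rw [preGNS_norm_sq, preGNS_norm_sq]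
      have := OrderHomClass.mono f (m.star_fst_mul_fst_le (f.ofPreGNS x))
      simpa using this

theorem multiplierPreGNS_apply (m : 𝓜(ℂ, B)) (x : f.PreGNS) :
    f.multiplierPreGNS m x = f.toPreGNS (m.fst (f.ofPreGNS x)) := rfl

/-- The extension of the GNS representation to the multiplier algebra. -/
noncomputable def gnsMultiplier : 𝓜(ℂ, B) →* (f.GNS →L[ℂ] f.GNS) where
  toFun m := (f.multiplierPreGNS m).completion
  map_one' := by
    ext x
    induction x using Completion.induction_on with
    | hp => exact isClosed_eq (by fun_prop) (by fun_prop)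
    | ih x => simp [multiplierPreGNS_apply]
  map_mul' m n := by
    ext x
    induction x using Completion.induction_on with
    | hp => exact isClosed_eq (by fun_prop) (by fun_prop)
    | ih x => simp [multiplierPreGNS_apply]

theorem gnsMultiplier_coe (m : 𝓜(ℂ, B)) (x : f.PreGNS) :
    f.gnsMultiplier m x = (f.multiplierPreGNS m x : f.GNS) := by
  simp [gnsMultiplier]

theorem repExtendsTo_gnsMultiplier (m : 𝓜(ℂ, B)) :
    RepExtendsTo f.gnsNonUnitalStarAlgHom m (f.gnsMultiplier m) := by
  intro b
  ext x
  induction x using Completion.induction_on with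
  | hp => exact isClosed_eq (by fun_prop) (by fun_prop)
  | ih x => simp [gnsMultiplier_coe, multiplierPreGNS_apply, fst_mul]

/-- Every positive element is of the form `q* q`, so `B` is spanned by products; no cyclic vector is
needed. -/
theorem isNondegenerateRep_gns : IsNondegenerateRep f.gnsNonUnitalStarAlgHom := by
  have key : ∀ b : B, ((f.toPreGNS b : f.PreGNS) : f.GNS) ∈ Submodule.span ℂ
      (Set.range fun p : B × f.GNS => f.gnsNonUnitalStarAlgHom p.1 p.2) := by
    intro b
    have hb : b ∈ Submodule.span ℂ {x : B | 0 ≤ x} := by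
      rw [CStarAlgebra.span_nonneg]; trivial
    let e : B →ₗ[ℂ] f.GNS := (Completion.toComplL (𝕜 := ℂ)).toLinearMap ∘ₗ f.toPreGNS.toLinearMap
    refine (Submodule.span_le (p := (Submodule.span ℂ
      (Set.range fun p : B × f.GNS => f.gnsNonUnitalStarAlgHom p.1 p.2)).comap e)).2 ?_ hb
    intro p hp
    obtain ⟨q, rfl⟩ := CStarAlgebra.nonneg_iff_eq_star_mul_self.1 hp
    refine Submodule.subset_span ⟨(star q, (f.toPreGNS q : f.GNS)), ?_⟩
    simp [e]
  rw [IsNondegenerateRep, ← Submodule.dense_iff_topologicalClosure_eq_top]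
  refine (Completion.denseRange_coe (α := f.PreGNS)).mono ?_
  rintro _ ⟨x, rfl⟩
  exact key (f.ofPreGNS x)

/-- The vectors `b e` of the pre-Hilbert space tend to `b` when `e` runs over an approximate
unit. -/
theorem gns_ne_zero {b : B} (hb : f (star b * b) ≠ 0) : f.gnsNonUnitalStarAlgHom b ≠ 0 := by
  intro h0
  apply hb
  have h1 : ∀ c, f (star (b * c) * (b * c)) = 0 := by
    intro c
    have : f.gnsNonUnitalStarAlgHom b (f.toPreGNS c) = 0 := by rw [h0]; rfl
    rw [gnsNonUnitalStarAlgHom_apply_coe, ← norm_eq_zero, Completion.norm_coe] at this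
    have h2 := f.preGNS_norm_sq (f.leftMulMapPreGNS b (f.toPreGNS c))
    rw [this] at h2
    simpa using h2.symm
  have hl := CStarAlgebra.increasingApproximateUnit B
  have ht := hl.toIsApproximateUnit.tendsto_mul_left b
  have hc : Continuous fun x : B => f (star x * x) :=
    (map_continuous f).comp (by fun_prop)
  have := (hc.tendsto b).comp ht
  exact tendsto_nhds_unique this (tendsto_const_nhds.congr fun c => (h1 c).symm)

end PositiveLinearMap

end GNS

/-- A point outside a closed ideal is separated from it by a non-degenerate representation, which
extends to multipliers. -/
theorem IsClosedStarIdeal.exists_rep {B : Type u} [NonUnitalCStarAlgebra B] {J : Submodule ℂ B}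
    (hJ : IsClosedStarIdeal J) {b : B} (hb : b ∉ J) :
    ∃ (H : Type u) (_ : NormedAddCommGroup H) (_ : InnerProductSpace ℂ H) (_ : CompleteSpace H)
      (ρ : B →⋆ₙₐ[ℂ] (H →L[ℂ] H)) (T : 𝓜(ℂ, B) →* (H →L[ℂ] H)), IsNondegenerateRep ρ ∧
      (∀ m, RepExtendsTo ρ m (T m)) ∧ (∀ x ∈ J, ρ x = 0) ∧ ρ b ≠ 0 := by
  let _ := CStarAlgebra.spectralOrder B
  have := CStarAlgebra.spectralOrderedRing B
  obtain ⟨f, hfJ, hfb⟩ := hJ.exists_positive hb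
  refine ⟨f.GNS, inferInstance, inferInstance, inferInstance, f.gnsNonUnitalStarAlgHom,
    f.gnsMultiplier, f.isNondegenerateRep_gns, f.repExtendsTo_gnsMultiplier, fun x hx => ?_,
    f.gns_ne_zero hfb⟩
  ext y
  induction y using UniformSpace.Completion.induction_on with
  | hp => exact isClosed_eq (by fun_prop) (by fun_prop)
  | ih y =>
    rw [f.gnsNonUnitalStarAlgHom_apply_coe, zero_apply, ← norm_eq_zero,
      UniformSpace.Completion.norm_coe, ← sq_eq_zero_iff, ← Complex.ofReal_eq_zero]
    push_cast
    rw [f.preGNS_norm_sq]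
    exact hfJ _ (hJ.mul_mem_left _ (hJ.mul_mem_right hx _))

/-! ### Partial-isometric representations of totally ordered cones -/

section PartialIsometric

/-- The element `x = p q - p q p` satisfies `x x* = 0`, so `p q = p q p` is self-adjoint. -/
theorem commute_of_isIdempotentElem_mul {M : Type*} [NonUnitalNormedRing M] [StarRing M]
    [CStarRing M] {p q : M} (hp : IsStarProjection p) (hq : IsStarProjection q)
    (h : IsIdempotentElem (p * q)) : Commute p q := by
  have hps := hp.isSelfAdjoint.star_eq
  have hqs := hq.isSelfAdjoint.star_eq
  have hpp : ∀ x, p * (p * x) = p * x := fun x => by rw [← mul_assoc, hp.isIdempotentElem.eq]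
  have hqq : ∀ x, q * (q * x) = q * x := fun x => by rw [← mul_assoc, hq.isIdempotentElem.eq]
  have hpq : ∀ x, p * (q * (p * (q * x))) = p * (q * x) := fun x => by
    simpa only [mul_assoc] using congrArg (· * x) h.eq
  have h0 : (p * q - p * q * p) * star (p * q - p * q * p) = 0 := by
    simp only [star_sub, star_mul, hps, hqs, mul_sub, sub_mul, mul_assoc, hpp, hqq, hpq, sub_self]
  have h1 : p * q = p * q * p := sub_eq_zero.1 ((CStarRing.mul_star_self_eq_zero_iff _).1 h0)
  have h2 := congrArg star h1
  simp only [star_mul, hps, hqs] at h2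
  rw [commute_iff_eq, h2, h1, mul_assoc]

variable {Γ : Type v} [AddCommGroup Γ] [LinearOrder Γ] [IsOrderedAddMonoid Γ]
  {M : Type*} [NormedRing M] [StarRing M] {V : PosCone Γ → M}

theorem PosCone.exists_add_eq_or (s x : PosCone Γ) :
    (∃ u, x = u + s) ∨ ∃ u, s = u + x := by
  rcases le_total s x with h | h
  · exact .inl ⟨⟨x - s, sub_nonneg.2 h⟩, Subtype.ext (sub_add_cancel _ _).symm⟩
  · exact .inr ⟨⟨s - x, sub_nonneg.2 h⟩, Subtype.ext (sub_add_cancel _ _).symm⟩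

namespace IsPartialIsometricRep

variable (hV : IsPartialIsometricRep V)
include hV

theorem star_partialIsometry (s : PosCone Γ) : star (V s) * V s * star (V s) = star (V s) := by
  have := congrArg star (hV.partialIsometry s)
  simpa [mul_assoc] using this

theorem isStarProjection_initial (s : PosCone Γ) : IsStarProjection (star (V s) * V s) :=
  ⟨by rw [IsIdempotentElem, ← mul_assoc, hV.star_partialIsometry], .star_mul_self _⟩

theorem isStarProjection_final (s : PosCone Γ) : IsStarProjection (V s * star (V s)) :=
  ⟨by rw [IsIdempotentElem, ← mul_assoc, hV.partialIsometry], .mul_star_self _⟩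

/-- Initial and final projections commute: this is equivalent to `V s * V t = V (s + t)` being a
partial isometry. -/
theorem commute_initial_final [CStarRing M] (s t : PosCone Γ) :
    Commute (star (V s) * V s) (V t * star (V t)) := by
  refine commute_of_isIdempotentElem_mul (hV.isStarProjection_initial s)
    (hV.isStarProjection_final t) ?_
  have h := hV.partialIsometry (s + t)
  rw [hV.map_add, star_mul] at h
  have := congrArg (fun x => star (V s) * x * star (V t)) h
  simpa only [IsIdempotentElem, mul_assoc] using this

/-- In a word `V_s V_x*` with `s ≤ x` the factor `V_s` can be cancelled at the cost of a final
projection. -/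
theorem mul_star_add [CStarRing M] (s u : PosCone Γ) :
    V s * star (V (u + s)) = star (V u) * (V (u + s) * star (V (u + s))) := by
  calc V s * star (V (u + s)) = V s * star (V s) * star (V u) := by
        rw [hV.map_add, star_mul, mul_assoc]
    _ = V s * star (V s) * (star (V u) * V u) * star (V u) := by
        rw [mul_assoc _ (star (V u) * V u), hV.star_partialIsometry]
    _ = star (V u) * V u * (V s * star (V s)) * star (V u) := by
        rw [(hV.commute_initial_final u s).eq]
    _ = star (V u) * (V (u + s) * star (V (u + s))) := by
        rw [hV.map_add, star_mul]
        simp only [mul_assoc]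

theorem mul_one_sub_initial_eq_zero (u t : PosCone Γ) :
    V (u + t) * (1 - star (V t) * V t) = 0 := by
  rw [hV.map_add, mul_assoc, mul_sub, mul_one, ← mul_assoc (V t), hV.partialIsometry, sub_self,
    mul_zero]

theorem mul_one_sub_initial_add [CStarRing M] (w u : PosCone Γ) :
    V u * (1 - star (V (w + u)) * V (w + u)) = (1 - star (V w) * V w) * V u := by
  have h : V u * star (V u) * (star (V w) * V w) * V u = star (V w) * V w * V u := by
    rw [← (hV.commute_initial_final w u).eq, mul_assoc, hV.partialIsometry]
  rw [mul_sub, sub_mul, mul_one, one_mul, ← h, hV.map_add, star_mul]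
  simp only [mul_assoc]

end IsPartialIsometricRep

end PartialIsometric

/-! ### The ideal generated by the defect projections -/

/-- A non-degenerate homomorphism carries approximate units of `A` to approximate units of `B`. -/
theorem IsNondegenerateHom.tendsto_approximateUnit {A B : Type*} [NonUnitalCStarAlgebra A]
    [NonUnitalCStarAlgebra B] [PartialOrder A] {f : A →⋆ₙₐ[ℂ] B} (hf : IsNondegenerateHom f)
    {l : Filter A} (hl : l.IsIncreasingApproximateUnit) (b : B) :
    Filter.Tendsto (fun e => f e * b) l (nhds b) := by
  let S : Submodule ℂ B :=
    { carrier := {b | Filter.Tendsto (fun e => f e * b) l (nhds b)}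
      zero_mem' := by simpa using tendsto_const_nhds
      add_mem' := fun {x y} hx hy => by
        simpa only [Set.mem_ofPred_eq, mul_add] using Filter.Tendsto.add hx hy
      smul_mem' := fun c x hx => by
        simpa only [Set.mem_ofPred_eq, mul_smul_comm] using Filter.Tendsto.const_smul hx c }
  have hS : IsClosed (S : Set B) := by
    refine isClosed_of_closure_subset fun x hx => ?_
    change Filter.Tendsto _ _ _
    rw [Metric.tendsto_nhds]
    intro ε hε
    obtain ⟨y, hy, hxy⟩ := Metric.mem_closure_iff.1 hx (ε / 3) (by positivity)
    filter_upwards [hl.eventually_norm, Metric.tendsto_nhds.1 hy (ε / 3) (by positivity)]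
      with e he hey
    have h1 : dist (f e * x) (f e * y) < ε / 3 := by
      rw [dist_eq_norm, ← mul_sub]
      refine (norm_mul_le _ _).trans_lt ?_
      rw [dist_eq_norm] at hxy
      exact (mul_le_of_le_one_left (norm_nonneg _)
        ((NonUnitalStarAlgHom.norm_apply_le f e).trans he)).trans_lt hxy
    have h2 := dist_triangle4 (f e * x) (f e * y) y x
    rw [dist_comm y x] at h2
    linarith
  have hb : b ∈ (Submodule.span ℂ
      (Set.range fun p : A × B => f p.1 * p.2)).topologicalClosure := by
    rw [show _ = _ from hf]; trivial
  refine Submodule.topologicalClosure_minimal (t := S) _ (Submodule.span_le.2 ?_) hS hb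
  rintro _ ⟨⟨a, c⟩, rfl⟩
  change Filter.Tendsto _ _ _
  have h := ((map_continuous f).tendsto a).comp (hl.toIsApproximateUnit.tendsto_mul_right a)
  simpa only [Function.comp_def, map_mul, mul_assoc] using h.mul_const c

section Ideal

variable {A : Type u} [NonUnitalCStarAlgebra A]
  {Γ : Type v} [AddCommGroup Γ] [LinearOrder Γ]
  {B : Type*} [NonUnitalCStarAlgebra B]
  {jA : A →⋆ₙₐ[ℂ] B} {jΓ : PosCone Γ → 𝓜(ℂ, B)}

/-- The generators of the kernel: `j(x)* j(a) (1 - j(t)* j(t)) j(y)`. -/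
def defectGenerators (jA : A →⋆ₙₐ[ℂ] B) (jΓ : PosCone Γ → 𝓜(ℂ, B)) : Set B :=
  {c : B | ∃ (a : A) (x y t : PosCone Γ),
    c = multiplierSandwich (B := B) (star (jΓ x)) (jA a) ((1 - star (jΓ t) * jΓ t) * jΓ y)}

/-- The closed linear span of the elements `j(x)* j(a) (1 - j(t)* j(t)) j(y)`. -/
noncomputable def defectIdeal (jA : A →⋆ₙₐ[ℂ] B) (jΓ : PosCone Γ → 𝓜(ℂ, B)) : Submodule ℂ B :=
  (Submodule.span ℂ (defectGenerators jA jΓ)).topologicalClosure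

theorem mem_of_mem_closure_span {s : Set B} {J : Submodule ℂ B} (hJ : IsClosed (J : Set B))
    (L : B →L[ℂ] B) (h : ∀ x ∈ s, L x ∈ J) {x : B}
    (hx : x ∈ (Submodule.span ℂ s).topologicalClosure) : L x ∈ J :=
  Submodule.topologicalClosure_minimal (t := J.comap L.toLinearMap) _ (Submodule.span_le.2 h)
    (hJ.preimage L.continuous) hx

theorem mem_defectIdeal_of_coe_eq {w : B} {a : A} {x y t : PosCone Γ}
    (hw : DoubleCentralizer.coe ℂ w = star (jΓ x) * DoubleCentralizer.coe ℂ (jA a) *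
      ((1 - star (jΓ t) * jΓ t) * jΓ y)) : w ∈ defectIdeal jA jΓ := by
  refine Submodule.le_topologicalClosure _ (Submodule.subset_span ⟨a, x, y, t, ?_⟩)
  apply coe_injective
  rw [hw, coe_multiplierSandwich]

theorem isClosed_defectIdeal : IsClosed (defectIdeal jA jΓ : Set B) :=
  Submodule.isClosed_topologicalClosure _

variable [IsOrderedAddMonoid Γ] {α : EndAction A Γ}
  (h : IsPisoCovariant α (fun a => DoubleCentralizer.coe ℂ (jA a)) jΓ)
include h

namespace IsPisoCovariant

theorem one_sub_commute (t : PosCone Γ) (a : A) :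
    Commute (1 - star (jΓ t) * jΓ t) (DoubleCentralizer.coe ℂ (jA a)) :=
  (Commute.one_left _).sub_left (h.commute t a)

theorem mul_algebra (s : PosCone Γ) (a : A) :
    jΓ s * DoubleCentralizer.coe ℂ (jA a) =
      DoubleCentralizer.coe ℂ (jA (α.toEnd s a)) * jΓ s := by
  rw [h.covariant, mul_assoc, mul_assoc, ← h.commute, ← mul_assoc, ← mul_assoc,
    h.rep.partialIsometry]

theorem algebra_mul_star (s : PosCone Γ) (a : A) :
    DoubleCentralizer.coe ℂ (jA a) * star (jΓ s) =
      star (jΓ s) * DoubleCentralizer.coe ℂ (jA (α.toEnd s a)) := by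
  have := congrArg star (h.mul_algebra s (star a))
  simpa [star_coe, ← map_star] using this

theorem map_zero_eq_one (hjA : IsNondegenerateHom jA) : jΓ 0 = 1 := by
  have h0 : jΓ 0 * jΓ 0 = jΓ 0 := by rw [← h.rep.map_add, add_zero]
  have h1 : ∀ a, jΓ 0 * DoubleCentralizer.coe ℂ (jA a) = DoubleCentralizer.coe ℂ (jA a) := by
    intro a
    have := h.covariant 0 a
    rw [α.toEnd_zero] at this
    change DoubleCentralizer.coe ℂ (jA a) = _ at this
    rw [this, ← mul_assoc, ← mul_assoc, h0]
  have h2 : star (jΓ 0) = 1 := by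
    refine ext_fst fun b => hjA.eq_of_mul_left fun a => ?_
    apply coe_injective
    rw [← central, ← central]
    have := congrArg star (h1 (star a))
    rw [star_mul, star_coe, ← map_star, star_star, coe_mul] at this
    rw [coe_injective this]
    rfl
  rw [← star_star (jΓ 0), h2, star_one]

/-- Multiplication by a final projection carries `j(A)` into its closure: if `e` runs over an
approximate unit of `A`, then `V_x V_x* j(a)` is the limit of `V_x j(e) V_x* j(a)`, which is
`j(α_x(e) a)`. -/
theorem final_mul_mem_closure (hjA : IsNondegenerateHom jA) (x : PosCone Γ) (a : A) :
    (jΓ x * star (jΓ x)).fst (jA a) ∈ closure (Set.range jA) := by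
  let _ := CStarAlgebra.spectralOrder A
  have := CStarAlgebra.spectralOrderedRing A
  have hl := CStarAlgebra.increasingApproximateUnit A
  have ht := hjA.tendsto_approximateUnit hl ((star (jΓ x)).fst (jA a))
  have ht' := ((jΓ x).fst.continuous.tendsto _).comp ht
  refine mem_closure_of_tendsto ht' (.of_forall fun e => ⟨α.toEnd x e * a, ?_⟩)
  apply coe_injective
  have hc := h.covariant x e
  simp only [Function.comp_apply]
  rw [← mul_coe, ← mul_coe_coe, ← mul_coe, map_mul, ← mul_coe_coe, hc]
  simp only [mul_assoc]

theorem fst_star_mem_defectIdeal (s : PosCone Γ) {w : B} (hw : w ∈ defectIdeal jA jΓ) :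
    (star (jΓ s)).fst w ∈ defectIdeal jA jΓ := by
  refine mem_of_mem_closure_span isClosed_defectIdeal _ ?_ hw
  rintro _ ⟨a, x, y, t, rfl⟩
  refine mem_defectIdeal_of_coe_eq (a := a) (x := x + s) (y := y) (t := t) ?_
  rw [← mul_coe, coe_multiplierSandwich, h.rep.map_add, star_mul]
  simp only [mul_assoc]

theorem algebra_mul_mem_defectIdeal (a' : A) {w : B} (hw : w ∈ defectIdeal jA jΓ) :
    jA a' * w ∈ defectIdeal jA jΓ := by
  refine mem_of_mem_closure_span isClosed_defectIdeal (ContinuousLinearMap.mul ℂ B (jA a')) ?_ hw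
  rintro _ ⟨a, x, y, t, rfl⟩
  refine mem_defectIdeal_of_coe_eq (a := α.toEnd x a' * a) (x := x) (y := y) (t := t) ?_
  rw [ContinuousLinearMap.mul_apply', ← mul_coe_coe, coe_multiplierSandwich, map_mul,
    ← mul_coe_coe, ← mul_assoc, ← mul_assoc, ← mul_assoc (star (jΓ x)), ← h.algebra_mul_star]
  simp only [mul_assoc]

/-- The total order is used here: `V_u (1 - V_t* V_t)` is zero if `t ≤ u`, and it is
`(1 - V_w* V_w) V_u` if `t = w + u`. -/
theorem sandwich_mem_defectIdeal (hjA : IsNondegenerateHom jA) (a : A) (u t y : PosCone Γ) :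
    multiplierSandwich (jΓ u) (jA a) ((1 - star (jΓ t) * jΓ t) * jΓ y) ∈ defectIdeal jA jΓ := by
  have hc : DoubleCentralizer.coe ℂ
      (multiplierSandwich (jΓ u) (jA a) ((1 - star (jΓ t) * jΓ t) * jΓ y)) =
      DoubleCentralizer.coe ℂ (jA (α.toEnd u a)) *
        (jΓ u * (1 - star (jΓ t) * jΓ t) * jΓ y) := by
    rw [coe_multiplierSandwich, h.mul_algebra]
    simp only [mul_assoc]
  rcases PosCone.exists_add_eq_or u t with ⟨w, rfl⟩ | ⟨w, rfl⟩
  · refine mem_defectIdeal_of_coe_eq (a := α.toEnd u a) (x := 0) (y := u + y) (t := w) ?_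
    rw [hc, h.rep.mul_one_sub_initial_add, h.map_zero_eq_one hjA, star_one, one_mul,
      h.rep.map_add u y, mul_assoc _ (jΓ u)]
  · rw [h.rep.mul_one_sub_initial_eq_zero, zero_mul, mul_zero] at hc
    rw [coe_injective (hc.trans (map_zero (coeHom : B →⋆ₙₐ[ℂ] 𝓜(ℂ, B))).symm)]
    exact Submodule.zero_mem _

/-- If `x = u + s` then `V_s V_x* j(a) = V_u* (V_x V_x* j(a))`, and if `s = u + x` then
`V_s V_x* j(a) = V_u (V_x V_x* j(a))`; in both cases the last factor is a limit of elements of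
`j(A)`. -/
theorem fst_mem_defectIdeal (hjA : IsNondegenerateHom jA) (s : PosCone Γ) {w : B}
    (hw : w ∈ defectIdeal jA jΓ) : (jΓ s).fst w ∈ defectIdeal jA jΓ := by
  refine mem_of_mem_closure_span isClosed_defectIdeal _ ?_ hw
  rintro _ ⟨a, x, y, t, rfl⟩
  have hcl : ∀ m n : 𝓜(ℂ, B), (∀ a, multiplierSandwich m (jA a) n ∈ defectIdeal jA jΓ) →
      multiplierSandwich m ((jΓ x * star (jΓ x)).fst (jA a)) n ∈ defectIdeal jA jΓ := by
    intro m n hmn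
    refine closure_minimal (t := {d | multiplierSandwich m d n ∈ defectIdeal jA jΓ}) ?_
      (isClosed_defectIdeal.preimage (m.fst.comp n.snd).continuous)
      (h.final_mul_mem_closure hjA x a)
    rintro _ ⟨a, rfl⟩
    exact hmn a
  rcases PosCone.exists_add_eq_or s x with ⟨u, rfl⟩ | ⟨u, rfl⟩
  · convert hcl (star (jΓ u)) ((1 - star (jΓ t) * jΓ t) * jΓ y) fun a =>
      mem_defectIdeal_of_coe_eq (coe_multiplierSandwich _ _ _) using 1
    apply coe_injective
    rw [← mul_coe, coe_multiplierSandwich, coe_multiplierSandwich, ← mul_coe,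
      ← mul_assoc (star (jΓ u)), ← h.rep.mul_star_add]
    simp only [mul_assoc]
  · convert hcl (jΓ u) _ fun a => h.sandwich_mem_defectIdeal hjA a u t y using 1
    apply coe_injective
    rw [← mul_coe, coe_multiplierSandwich, coe_multiplierSandwich, ← mul_coe, h.rep.map_add]
    simp only [mul_assoc]

theorem isClosedStarIdeal_defectIdeal (hjA : IsNondegenerateHom jA)
    (hspan : (Submodule.span ℂ (Set.range fun p : PosCone Γ × A × PosCone Γ =>
      multiplierSandwich (B := B) (star (jΓ p.1)) (jA p.2.1) (jΓ p.2.2))).topologicalClosure = ⊤) :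
    IsClosedStarIdeal (defectIdeal jA jΓ) where
  isClosed := isClosed_defectIdeal
  mul_mem_left b w hw := by
    have hb : b ∈ (⊤ : Submodule ℂ B) := trivial
    rw [← hspan] at hb
    refine mem_of_mem_closure_span isClosed_defectIdeal ((ContinuousLinearMap.mul ℂ B).flip w) ?_ hb
    rintro _ ⟨⟨x, a, y⟩, rfl⟩
    have := h.fst_star_mem_defectIdeal x (h.algebra_mul_mem_defectIdeal a
      (h.fst_mem_defectIdeal hjA y hw))
    convert this using 1
    apply coe_injective
    rw [← mul_coe, ← mul_coe_coe, ← mul_coe, ContinuousLinearMap.flip_apply,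
      ContinuousLinearMap.mul_apply', ← mul_coe_coe, coe_multiplierSandwich]
    simp only [mul_assoc]
  star_mem {w} hw := by
    have hs : ∀ x ∈ defectGenerators jA jΓ, star x ∈ defectIdeal jA jΓ := by
      rintro _ ⟨a, x, y, t, rfl⟩
      refine mem_defectIdeal_of_coe_eq (a := star a) (x := y) (y := x) (t := t) ?_
      rw [← star_coe, coe_multiplierSandwich]
      simp only [star_mul, star_sub, star_star, star_one, star_coe, ← map_star]
      rw [mul_assoc, ← mul_assoc _ _ (jΓ x), (h.one_sub_commute t (star a)).eq]
      simp only [mul_assoc]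
    refine Submodule.topologicalClosure_minimal
      (t := (defectIdeal jA jΓ).comap (starLinearEquiv ℂ : B ≃ₗ⋆[ℂ] B).toLinearMap) _
      (Submodule.span_le.2 hs) ?_ hw
    exact isClosed_defectIdeal.preimage continuous_star

end IsPisoCovariant

end Ideal

/-! ### Covariant pairs in representations -/

section Covariance

variable {A : Type u} [NonUnitalCStarAlgebra A]
  {Γ : Type v} [AddCommGroup Γ] [LinearOrder Γ] [IsOrderedAddMonoid Γ] {α : EndAction A Γ}
  {M N : Type*} [Monoid M] [StarMul M] [Monoid N] [StarMul N]

theorem IsIsoCovariant.isPisoCovariant {π : A → M} {V : PosCone Γ → M}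
    (h : IsIsoCovariant α π V) : IsPisoCovariant α π V where
  rep :=
    { partialIsometry := fun s => by rw [mul_assoc, h.rep.isometry, mul_one]
      map_add := h.rep.map_add }
  covariant := h.covariant
  commute s a := by rw [h.rep.isometry, one_mul, mul_one]

theorem IsPisoCovariant.map {π : A → M} {V : PosCone Γ → M} (h : IsPisoCovariant α π V)
    (T : M →* N) (hT : ∀ m, T (star m) = star (T m)) :
    IsPisoCovariant α (fun a => T (π a)) (fun s => T (V s)) where
  rep :=
    { partialIsometry := fun s => by rw [← hT, ← map_mul, ← map_mul, h.rep.partialIsometry]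
      map_add := fun s t => by rw [h.rep.map_add, map_mul] }
  covariant s a := by rw [h.covariant, map_mul, map_mul, hT]
  commute s a := by rw [← hT, ← map_mul, ← map_mul, h.commute, map_mul]

end Covariance

section Main

variable {A : Type u} [NonUnitalCStarAlgebra A]
  {Γ : Type v} [AddCommGroup Γ] [LinearOrder Γ]
  {B C : Type*} [NonUnitalCStarAlgebra B] [NonUnitalCStarAlgebra C]
  {jA : A →⋆ₙₐ[ℂ] B} {jΓ : PosCone Γ → 𝓜(ℂ, B)} {iA : A →⋆ₙₐ[ℂ] C} {iΓ : PosCone Γ → 𝓜(ℂ, C)}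
  {H : Type*} [NormedAddCommGroup H] [InnerProductSpace ℂ H] [CompleteSpace H]

theorem IsNondegenerateRep.comp {ρ : B →⋆ₙₐ[ℂ] (H →L[ℂ] H)} (hρ : IsNondegenerateRep ρ)
    (hjA : IsNondegenerateHom jA) : IsNondegenerateRep (ρ.comp jA) := by
  rw [IsNondegenerateRep, eq_top_iff, ← show _ = _ from hρ]
  refine Submodule.topologicalClosure_minimal _ (Submodule.span_le.2 ?_)
    (Submodule.isClosed_topologicalClosure _)
  rintro _ ⟨⟨b, h⟩, rfl⟩
  have hb : b ∈ (Submodule.span ℂ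
      (Set.range fun p : A × B => jA p.1 * p.2)).topologicalClosure := by
    rw [show _ = _ from hjA]; trivial
  let L : B →L[ℂ] H := ⟨(LinearMap.applyₗ h) ∘ₗ (ContinuousLinearMap.coeLM ℂ) ∘ₗ (ρ : B →ₗ[ℂ] _),
    (ContinuousLinearMap.apply ℂ H h).continuous.comp (map_continuous ρ)⟩
  refine Submodule.topologicalClosure_minimal (t := Submodule.comap L.toLinearMap
    (Submodule.topologicalClosure _)) _ (Submodule.span_le.2 ?_)
    ((Submodule.isClosed_topologicalClosure _).preimage L.continuous) hb
  rintro _ ⟨⟨a, c⟩, rfl⟩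
  refine Submodule.le_topologicalClosure _ (Submodule.subset_span ⟨(a, ρ c h), ?_⟩)
  change ρ (jA a) (ρ c h) = ρ (jA a * c) h
  rw [map_mul]
  rfl

section Extension

variable [IsOrderedAddMonoid Γ] {α : EndAction A Γ}
  {ρ : B →⋆ₙₐ[ℂ] (H →L[ℂ] H)} (hρ : IsNondegenerateRep ρ)
  {T : 𝓜(ℂ, B) →* (H →L[ℂ] H)} (hT : ∀ m, RepExtendsTo ρ m (T m))
include hρ hT

theorem RepExtendsTo.map_star (m : 𝓜(ℂ, B)) : T (Star.star m) = Star.star (T m) :=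
  hρ.ext fun b => by rw [← hT, (hT m).star hρ]

theorem RepExtendsTo.map_coe (b : B) : T (DoubleCentralizer.coe ℂ b) = ρ b :=
  hρ.ext fun c => by rw [← hT, ← map_mul]; rfl

theorem IsPisoCovariant.comp_rep
    (h : IsPisoCovariant α (fun a => DoubleCentralizer.coe ℂ (jA a)) jΓ) :
    IsPisoCovariant α (ρ.comp jA) (fun s => T (jΓ s)) := by
  have := h.map T (RepExtendsTo.map_star hρ hT)
  simp only [RepExtendsTo.map_coe hρ hT] at this
  exact this

/-- A covariant partial-isometric pair becomes isometric in every representation that kills the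
defect ideal. -/
theorem IsPisoCovariant.isIsoCovariant_comp_rep (hjA : IsNondegenerateHom jA)
    (h : IsPisoCovariant α (fun a => DoubleCentralizer.coe ℂ (jA a)) jΓ)
    (hJ : ∀ x ∈ defectIdeal jA jΓ, ρ x = 0) :
    IsIsoCovariant α (ρ.comp jA) (fun s => T (jΓ s)) where
  rep :=
    { isometry := fun s => by
        refine (hρ.comp hjA).ext fun a => ?_
        have hz : ρ ((1 - star (jΓ s) * jΓ s).fst (jA a)) = 0 := by
          refine hJ _ (mem_defectIdeal_of_coe_eq (a := a) (x := 0) (y := 0) (t := s) ?_)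
          rw [← mul_coe, (h.one_sub_commute s a).eq, h.map_zero_eq_one hjA, star_one, one_mul,
            mul_one]
        rw [sub_fst, sub_apply, map_sub, sub_eq_zero, hT, hT, map_one,
          map_mul, RepExtendsTo.map_star hρ hT] at hz
        exact hz.symm
      map_add := (h.comp_rep hρ hT).rep.map_add }
  covariant := (h.comp_rep hρ hT).covariant

end Extension

/-- A natural homomorphism has prescribed values on the elements `j(x)* j(a) j(y)`, which span the
partial-isometric crossed product. -/
theorem IsNaturalHom.map_sandwich {φ : B →⋆ₙₐ[ℂ] C} (hφ : IsNaturalHom jA jΓ iA iΓ φ)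
    (x y : PosCone Γ) (a : A) : φ (multiplierSandwich (star (jΓ x)) (jA a) (jΓ y)) =
      multiplierSandwich (star (iΓ x)) (iA a) (iΓ y) := by
  rw [((hφ.map_semigroup x).star hφ.nondegenerate).map_sandwich hφ.nondegenerate
    (hφ.map_semigroup y), hφ.map_algebra]

theorem IsNaturalHom.map_defectIdeal [IsOrderedAddMonoid Γ] {φ : B →⋆ₙₐ[ℂ] C}
    (hφ : IsNaturalHom jA jΓ iA iΓ φ)
    (hi : IsIsometricRep iΓ) {b : B} (hb : b ∈ defectIdeal jA jΓ) : φ b = 0 := by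
  refine Submodule.topologicalClosure_minimal (t := LinearMap.ker (φ : B →ₗ[ℂ] C)) _
    (Submodule.span_le.2 ?_) (isClosed_singleton.preimage (map_continuous φ)) hb
  rintro _ ⟨a, x, y, t, rfl⟩
  have hn := hφ.nondegenerate
  have hs := hφ.map_semigroup
  change φ _ = 0
  rw [((hs x).star hn).map_sandwich hn
    (((HomExtendsTo.one φ).sub (((hs t).star hn).mul (hs t))).mul (hs y)), hi.isometry, sub_self,
    zero_mul]
  simp [multiplierSandwich]

end Main

/-! ### The natural homomorphism and its kernel -/

section Universal

variable {A : Type u} [NonUnitalCStarAlgebra A]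
  {Γ : Type v} [AddCommGroup Γ] [LinearOrder Γ]
  {B C : Type (max u v)} [NonUnitalCStarAlgebra B] [NonUnitalCStarAlgebra C]
  {jA : A →⋆ₙₐ[ℂ] B} {jΓ : PosCone Γ → 𝓜(ℂ, B)} {iA : A →⋆ₙₐ[ℂ] C} {iΓ : PosCone Γ → 𝓜(ℂ, C)}

/-- Representations `ρ` of `B` and `σ` of `C` on the same space that restrict to the same
covariant pair. -/
structure IsCompatibleReps (jA : A →⋆ₙₐ[ℂ] B) (jΓ : PosCone Γ → 𝓜(ℂ, B)) (iA : A →⋆ₙₐ[ℂ] C)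
    (iΓ : PosCone Γ → 𝓜(ℂ, C)) {H : Type*} [NormedAddCommGroup H] [InnerProductSpace ℂ H]
    [CompleteSpace H] (ρ : B →⋆ₙₐ[ℂ] (H →L[ℂ] H)) (σ : C →⋆ₙₐ[ℂ] (H →L[ℂ] H)) : Prop where
  nondegenerate_left : IsNondegenerateRep ρ
  nondegenerate_right : IsNondegenerateRep σ
  algebra : ∀ a, ρ (jA a) = σ (iA a)
  semigroup : ∀ s, ∃ T, RepExtendsTo ρ (jΓ s) T ∧ RepExtendsTo σ (iΓ s) T

/-- The graph of the natural homomorphism: the pairs that are identified by all compatible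
representations. -/
def naturalGraph (jA : A →⋆ₙₐ[ℂ] B) (jΓ : PosCone Γ → 𝓜(ℂ, B)) (iA : A →⋆ₙₐ[ℂ] C)
    (iΓ : PosCone Γ → 𝓜(ℂ, C)) : NonUnitalStarSubalgebra ℂ (B × C) where
  carrier := {p | ∀ (H : Type (max u v)) [NormedAddCommGroup H] [InnerProductSpace ℂ H]
    [CompleteSpace H] (ρ : B →⋆ₙₐ[ℂ] (H →L[ℂ] H)) (σ : C →⋆ₙₐ[ℂ] (H →L[ℂ] H)),
    IsCompatibleReps jA jΓ iA iΓ ρ σ → ρ p.1 = σ p.2}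
  add_mem' hx hy H _ _ _ ρ σ h := by
    rw [Prod.fst_add, Prod.snd_add, map_add, map_add, hx H ρ σ h, hy H ρ σ h]
  zero_mem' H _ _ _ ρ σ h := by rw [Prod.fst_zero, Prod.snd_zero, map_zero, map_zero]
  mul_mem' hx hy H _ _ _ ρ σ h := by
    rw [Prod.fst_mul, Prod.snd_mul, map_mul, map_mul, hx H ρ σ h, hy H ρ σ h]
  smul_mem' c x hx H _ _ _ ρ σ h := by
    rw [Prod.smul_fst, Prod.smul_snd, map_smul, map_smul, hx H ρ σ h]
  star_mem' hx H _ _ _ ρ σ h := by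
    rw [Prod.fst_star, Prod.snd_star, map_star, map_star, hx H ρ σ h]

theorem isClosed_naturalGraph : IsClosed (naturalGraph jA jΓ iA iΓ : Set (B × C)) := by
  change IsClosed {p : B × C | ∀ (H : Type (max u v)) [NormedAddCommGroup H]
    [InnerProductSpace ℂ H] [CompleteSpace H] (ρ : B →⋆ₙₐ[ℂ] (H →L[ℂ] H))
    (σ : C →⋆ₙₐ[ℂ] (H →L[ℂ] H)), IsCompatibleReps jA jΓ iA iΓ ρ σ → ρ p.1 = σ p.2}
  simp only [Set.ofPred_forall]
  refine isClosed_iInter fun H => isClosed_iInter fun _ => isClosed_iInter fun _ =>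
    isClosed_iInter fun _ => isClosed_iInter fun ρ => isClosed_iInter fun σ =>
    isClosed_iInter fun _ => isClosed_eq ((map_continuous ρ).comp continuous_fst)
      ((map_continuous σ).comp continuous_snd)

theorem algebra_mem_naturalGraph (a : A) : (jA a, iA a) ∈ naturalGraph jA jΓ iA iΓ :=
  fun _ _ _ _ _ _ h => h.algebra a

theorem fst_mem_naturalGraph (s : PosCone Γ) {b : B} {c : C}
    (h : (b, c) ∈ naturalGraph jA jΓ iA iΓ) :
    ((jΓ s).fst b, (iΓ s).fst c) ∈ naturalGraph jA jΓ iA iΓ := by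
  intro H _ _ _ ρ σ hρσ
  obtain ⟨T, hT, hT'⟩ := hρσ.semigroup s
  exact (hT b).trans ((congrArg (T * ·) (h H ρ σ hρσ)).trans (hT' c).symm)

theorem fst_star_mem_naturalGraph (s : PosCone Γ) {b : B} {c : C}
    (h : (b, c) ∈ naturalGraph jA jΓ iA iΓ) :
    ((star (jΓ s)).fst b, (star (iΓ s)).fst c) ∈ naturalGraph jA jΓ iA iΓ := by
  intro H _ _ _ ρ σ hρσ
  obtain ⟨T, hT, hT'⟩ := hρσ.semigroup s
  exact (hT.star hρσ.nondegenerate_left b).trans ((congrArg (star T * ·) (h H ρ σ hρσ)).trans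
    (hT'.star hρσ.nondegenerate_right c).symm)

theorem sandwich_mem_naturalGraph (x y : PosCone Γ) (a : A) :
    (multiplierSandwich (star (jΓ x)) (jA a) (jΓ y),
      multiplierSandwich (star (iΓ x)) (iA a) (iΓ y)) ∈ naturalGraph jA jΓ iA iΓ := by
  have h1 := fst_star_mem_naturalGraph (jΓ := jΓ) (iΓ := iΓ) y
    (algebra_mem_naturalGraph (jA := jA) (iA := iA) (star a))
  have h2 : ((jΓ y).snd (jA a), (iΓ y).snd (iA a)) ∈ naturalGraph jA jΓ iA iΓ := by
    have := star_mem h1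
    rw [Prod.star_def] at this
    simpa [map_star] using this
  exact fst_star_mem_naturalGraph x h2

variable [IsOrderedAddMonoid Γ] {α : EndAction A Γ}

theorem naturalGraph_right_unique (hB : IsPisoCrossedProduct α jA jΓ)
    (hC : IsIsoCrossedProduct α iA iΓ) {c : C} (h : (0, c) ∈ naturalGraph jA jΓ iA iΓ) :
    c = 0 := by
  by_contra hc
  obtain ⟨H, _, _, _, σ, T, hσ, hT, -, hσc⟩ :=
    isClosedStarIdeal_bot.exists_rep (b := c) (J := ⊥) (by simpa using hc)
  obtain ⟨ρ, hρ, hρA, hρΓ⟩ := hB.universal H (σ.comp iA) (fun s => T (iΓ s))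
    (hσ.comp hC.nondegenerate) (hC.covariant.isPisoCovariant.comp_rep hσ hT)
  exact hσc ((h H ρ σ ⟨hρ, hσ, hρA, fun s => ⟨_, hρΓ s, hT _⟩⟩).symm.trans (map_zero ρ))

theorem exists_mem_naturalGraph (hB : IsPisoCrossedProduct α jA jΓ) (b : B) :
    ∃ c, (b, c) ∈ naturalGraph jA jΓ iA iΓ := by
  have hcl : IsClosed (naturalGraph jA jΓ iA iΓ : Set (B × C)) := isClosed_naturalGraph
  let p : naturalGraph jA jΓ iA iΓ →⋆ₙₐ[ℂ] B :=
    (NonUnitalStarAlgHom.fst ℂ B C).comp (NonUnitalStarSubalgebraClass.subtype _)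
  have hr : IsClosed (LinearMap.range (p : naturalGraph jA jΓ iA iΓ →ₗ[ℂ] B) : Set B) :=
    isClosed_range_nonUnitalStarAlgHom p
  have hb : b ∈ (⊤ : Submodule ℂ B) := trivial
  rw [← hB.spanned] at hb
  have := Submodule.topologicalClosure_minimal
    (t := LinearMap.range (p : naturalGraph jA jΓ iA iΓ →ₗ[ℂ] B)) _
    (Submodule.span_le.2 (by
      rintro _ ⟨⟨x, a, y⟩, rfl⟩
      exact ⟨⟨_, sandwich_mem_naturalGraph (iA := iA) (iΓ := iΓ) x y a⟩, rfl⟩)) hr hb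
  obtain ⟨⟨⟨b', c⟩, h⟩, rfl⟩ := this
  exact ⟨c, h⟩

theorem exists_isNaturalHom (hB : IsPisoCrossedProduct α jA jΓ)
    (hC : IsIsoCrossedProduct α iA iΓ) : ∃ φ : B →⋆ₙₐ[ℂ] C, IsNaturalHom jA jΓ iA iΓ φ := by
  choose f hf using exists_mem_naturalGraph (iA := iA) (iΓ := iΓ) hB
  have huniq : ∀ {b c}, (b, c) ∈ naturalGraph jA jΓ iA iΓ → f b = c := fun {b c} h => by
    have := sub_mem (hf b) h
    rw [Prod.mk_sub_mk, sub_self] at this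
    exact sub_eq_zero.1 (naturalGraph_right_unique hB hC this)
  let φ : B →⋆ₙₐ[ℂ] C :=
    { toFun := f
      map_smul' := fun r b => huniq (SMulMemClass.smul_mem r (hf b))
      map_zero' := huniq (zero_mem _)
      map_add' := fun b b' => huniq (add_mem (hf b) (hf b'))
      map_mul' := fun b b' => huniq (mul_mem (hf b) (hf b'))
      map_star' := fun b => huniq (star_mem (hf b)) }
  have hφA : ∀ a, φ (jA a) = iA a := fun a => huniq (algebra_mem_naturalGraph a)
  refine ⟨φ, ⟨?_, hφA, fun s b => huniq (fst_mem_naturalGraph s (hf b))⟩⟩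
  rw [IsNondegenerateHom, eq_top_iff, ← show _ = _ from hC.nondegenerate]
  refine Submodule.topologicalClosure_mono (Submodule.span_mono ?_)
  rintro _ ⟨⟨a, c⟩, rfl⟩
  exact ⟨(jA a, c), by simp only [hφA]⟩

theorem IsNaturalHom.unique (hB : IsPisoCrossedProduct α jA jΓ) {φ ψ : B →⋆ₙₐ[ℂ] C}
    (hφ : IsNaturalHom jA jΓ iA iΓ φ) (hψ : IsNaturalHom jA jΓ iA iΓ ψ) : φ = ψ := by
  ext b
  have hb : b ∈ (⊤ : Submodule ℂ B) := trivial
  rw [← hB.spanned] at hb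
  refine Submodule.topologicalClosure_minimal
    (t := LinearMap.eqLocus (φ : B →ₗ[ℂ] C) (ψ : B →ₗ[ℂ] C)) _ (Submodule.span_le.2 ?_)
    (isClosed_eq (map_continuous φ) (map_continuous ψ)) hb
  rintro _ ⟨⟨x, a, y⟩, rfl⟩
  exact (hφ.map_sandwich x y a).trans (hψ.map_sandwich x y a).symm

theorem IsNaturalHom.surjective (hC : IsIsoCrossedProduct α iA iΓ) {φ : B →⋆ₙₐ[ℂ] C}
    (hφ : IsNaturalHom jA jΓ iA iΓ φ) : Function.Surjective φ := by
  intro c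
  have hc : c ∈ (⊤ : NonUnitalStarSubalgebra ℂ C) := trivial
  rw [← hC.generated] at hc
  have hr : IsClosed (NonUnitalStarAlgHom.range φ : Set C) := by
    simpa using! isClosed_range_nonUnitalStarAlgHom φ
  refine NonUnitalStarSubalgebra.topologicalClosure_minimal
    (t := NonUnitalStarAlgHom.range φ) _ (NonUnitalStarAlgebra.adjoin_le ?_) hr hc
  rintro _ ⟨⟨a, s⟩, rfl⟩
  exact ⟨multiplierSandwich 1 (jA a) (jΓ s),
    ((HomExtendsTo.one φ).map_sandwich hφ.nondegenerate (hφ.map_semigroup s) _).trans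
      (by rw [hφ.map_algebra])⟩

/-- A point `b` outside the defect ideal is not annihilated: a representation `σ` of `B` that kills
the ideal but not `b` yields an isometric covariant pair, hence a representation `ρ` of `C` with
`ρ ∘ φ = σ`. -/
theorem IsNaturalHom.mem_defectIdeal (hB : IsPisoCrossedProduct α jA jΓ)
    (hC : IsIsoCrossedProduct α iA iΓ) {φ : B →⋆ₙₐ[ℂ] C} (hφ : IsNaturalHom jA jΓ iA iΓ φ)
    {b : B} (hb : φ b = 0) : b ∈ defectIdeal jA jΓ := by
  by_contra hbJ
  obtain ⟨H, _, _, _, σ, T, hσ, hT, hσJ, hσb⟩ :=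
    (hB.covariant.isClosedStarIdeal_defectIdeal hB.nondegenerate hB.spanned).exists_rep hbJ
  obtain ⟨ρ, hρ, hρA, hρΓ⟩ := hC.universal H (σ.comp jA) (fun s => T (jΓ s))
    (hσ.comp hB.nondegenerate)
    (hB.covariant.isIsoCovariant_comp_rep hσ hT hB.nondegenerate hσJ)
  have key : ρ (φ b) = σ b := by
    have hb' : b ∈ (⊤ : Submodule ℂ B) := trivial
    rw [← hB.spanned] at hb'
    refine Submodule.topologicalClosure_minimal
      (t := LinearMap.eqLocus ((ρ.comp φ : B →⋆ₙₐ[ℂ] (H →L[ℂ] H)) : B →ₗ[ℂ] (H →L[ℂ] H))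
        (σ : B →ₗ[ℂ] (H →L[ℂ] H))) _ (Submodule.span_le.2 ?_)
      (isClosed_eq (map_continuous (ρ.comp φ)) (map_continuous σ)) hb'
    rintro _ ⟨⟨x, a, y⟩, rfl⟩
    change ρ (φ _) = σ _
    rw [hφ.map_sandwich, ((hρΓ x).star hρ).map_sandwich hρ (hρΓ y),
      ((hT _).star hσ).map_sandwich hσ (hT _), hρA]
    rfl
  exact hσb (by rw [← key, hb, map_zero])

end Universal

theorem proposition2p2 {A : Type u} [NonUnitalCStarAlgebra A]
    {Γ : Type v} [AddCommGroup Γ] [LinearOrder Γ] [IsOrderedAddMonoid Γ]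
    (α : EndAction A Γ)
    {B : Type (max u v)} [NonUnitalCStarAlgebra B]
    (jA : A →⋆ₙₐ[ℂ] B) (jΓ : PosCone Γ → 𝓜(ℂ, B)) (hB : IsPisoCrossedProduct α jA jΓ)
    {C : Type (max u v)} [NonUnitalCStarAlgebra C]
    (iA : A →⋆ₙₐ[ℂ] C) (iΓ : PosCone Γ → 𝓜(ℂ, C)) (hC : IsIsoCrossedProduct α iA iΓ) :
    (∃! φ : B →⋆ₙₐ[ℂ] C, IsNaturalHom jA jΓ iA iΓ φ) ∧
    ∀ φ : B →⋆ₙₐ[ℂ] C, IsNaturalHom jA jΓ iA iΓ φ →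
      Function.Surjective φ ∧
      ∀ b : B, φ b = 0 ↔
        b ∈ (Submodule.span ℂ {c : B | ∃ (a : A) (x y t : PosCone Γ),
          c = multiplierSandwich (B := B) (star (jΓ x)) (jA a)
            ((1 - star (jΓ t) * jΓ t) * jΓ y)}).topologicalClosure := by
  obtain ⟨φ, hφ⟩ := exists_isNaturalHom hB hC
  exact ⟨⟨φ, hφ, fun ψ hψ => hψ.unique hB hφ⟩, fun ψ hψ => ⟨hψ.surjective hC, fun _ =>
    ⟨hψ.mem_defectIdeal hB hC, hψ.map_defectIdeal hC.covariant.rep⟩⟩⟩
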